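/- Let $Q(\mathbf A) :- R_1(\mathbb A_1),\dots,R_m(\mathbb A_m)$ be a conjunctive query without self-joins (the relation names $R_1,\dots,R_m$ are distinct), whose attribute set $\mathbb A=\bigcup_i\mathbb A_i$ is finite and non-empty and whose set of output attributes is an arbitrary $\mathbf A\subseteq\mathbb A$. For a database $D$, i.e. finite relations $R_i^D$ of tuples over $\mathbb A_i$ with values in $\mathbb N$, let $N=|D|=\sum_i|R_i^D|$, and let $Q(D)$ be the projection onto $\mathbf A$ of the natural join of all $R_i^D$. A witness for $D$ is a sub-database $D'\subseteq D$ with $Q(D')=Q(D)$, and a solution to $\mathrm{SWP}(Q,D)$ is a witness with the fewest tuples. A smallest witness for a single result $t\in Q(D)$ is a sub-database $D'\subseteq D$ with $t\in Q(D')$ and with the fewest tuples. Let $\rho^*$ be the fractional edge covering number of $Q$, i.e. the minimum of $\sum_{i}W(R_i)$ over all $W:\{R_1,\dots,R_m\}\to[0,1]$ such that $\sum_{i:A\in\mathbb A_i}W(R_i)\ge 1$ for every $A\in\mathbb A$. Then SWP for $Q$ is $O(N^{1-1/\rho^*})$-approximable, with a constant depending only on $Q$: there is an algorithm (depending only on $Q$)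 that, given any database $D$, computes in time polynomial in $N$ a witness $D'$ for $D$ with $$|D'|\le m\cdot N^{1-1/\rho^*}\cdot|D^*|,$$ where $D^*$ is a solution to $\mathrm{SWP}(Q,D)$. Moreover, for every database $D$, every union of one smallest witness for each query result $t\in Q(D)$ is a witness $D'$ that satisfies this inequality, and such a union can be computed in time polynomial in $N$. Here time is the number of steps of a uniform-cost random access machine whose words are natural numbers, whose only arithmetic operations are addition and truncated subtraction, and which receives and returns a database as an arbitrarily ordered list of its tuples without repetition, with one word for each value. -/

import Mathlib

namespace SWP

/-! ### Conjunctive queries without self-joins, databases, query results -/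

/-- A conjunctive query without self-joins `Q(head) :- R_0(attr 0), …, R_{m-1}(attr (m-1))` with
`m = numRel` distinct relation names, over the attributes `0, …, numAttr - 1`. Every attribute
occurs in the body, and the output attributes `head` are an arbitrary set of attributes. -/
structure CQ where
  numAttr : ℕ
  numRel : ℕ
  attr : Fin numRel → Finset (Fin numAttr)
  head : Finset (Fin numAttr)
  covered : ∀ A : Fin numAttr, ∃ i : Fin numRel, A ∈ attr i

/-- A tuple over a set `X` of attributes; domain values are natural numbers. -/
abbrev Tuple {k : ℕ} (X : Finset (Fin k)) : Type := {A : Fin k // A ∈ X} → ℕ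

/-- The projection `π_X t` of a tuple over all attributes. -/
def proj {k : ℕ} (X : Finset (Fin k)) (t : Fin k → ℕ) : Tuple X := fun A => t A.1

/-- A fact `R_i(t)`: a relation name together with a tuple over the attributes of that relation. -/
abbrev Fact (Q : CQ) : Type := (i : Fin Q.numRel) × Tuple (Q.attr i)

/-- A database is a finite set of facts; the relation `R_i` of `D` is `{t | ⟨i, t⟩ ∈ D}`, so the
input size `N = |D| = ∑ i, |R_i|` is `D.card`. -/
abbrev Database (Q : CQ) : Type := Finset (Fact Q)

/-- The query result `Q(D)`: the projection of the natural join of all relations to `head`. -/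
def CQ.result (Q : CQ) (D : Database Q) : Set (Tuple Q.head) :=
  {u | ∃ t : Fin Q.numAttr → ℕ, (∀ i, (⟨i, proj (Q.attr i) t⟩ : Fact Q) ∈ D) ∧ u = proj Q.head t}

/-! ### Fractional edge covering number -/

/-- Fractional edge coverings `W : rels(Q) → [0,1]`. -/
def CQ.IsFracEdgeCovering (Q : CQ) (W : Fin Q.numRel → ℝ) : Prop :=
  (∀ i, 0 ≤ W i ∧ W i ≤ 1) ∧
    ∀ A : Fin Q.numAttr, 1 ≤ ∑ i ∈ Finset.univ.filter (fun i => A ∈ Q.attr i), W i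

/-- The fractional edge covering number `ρ*`: the least total weight of a fractional edge covering
(the set below is non-empty and compact, so its infimum is a minimum). -/
noncomputable def CQ.fracEdgeCoverNumber (Q : CQ) : ℝ :=
  sInf {r : ℝ | ∃ W : Fin Q.numRel → ℝ, Q.IsFracEdgeCovering W ∧ r = ∑ i, W i}

/-! ### The smallest witness problem and its approximation -/

/-- `D'` is a witness for `Q` and `D`. -/
def IsWitness (Q : CQ) (D D' : Database Q) : Prop := D' ⊆ D ∧ Q.result D' = Q.result D

/-- `D'` is a solution to `SWP(Q, D)`, a witness with the fewest facts. -/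
def IsSmallestWitness (Q : CQ) (D D' : Database Q) : Prop :=
  IsWitness Q D D' ∧ ∀ D'', IsWitness Q D D'' → D'.card ≤ D''.card

/-- `D'` is a `θ`-approximated solution to `SWP(Q, D)`. -/
def IsApproxSolution (Q : CQ) (θ : ℝ) (D D' : Database Q) : Prop :=
  IsWitness Q D D' ∧
    ∃ Dopt, IsSmallestWitness Q D Dopt ∧ (D'.card : ℝ) ≤ θ * (Dopt.card : ℝ)

/-- `D'` is a solution to `SWP(Q, D, t)`, the smallest witness problem for one query result. -/
def IsSmallestWitnessFor (Q : CQ) (D : Database Q) (t : Tuple Q.head) (D' : Database Q) : Prop :=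
  (D' ⊆ D ∧ t ∈ Q.result D') ∧ ∀ D'', D'' ⊆ D → t ∈ Q.result D'' → D'.card ≤ D''.card

/-- `D'` is the union of one smallest witness `w t` for each query result `t ∈ Q(D)`. -/
def IsUnionOfSmallestWitnesses (Q : CQ) (D D' : Database Q) : Prop :=
  ∃ w : Tuple Q.head → Database Q,
    (∀ t ∈ Q.result D, IsSmallestWitnessFor Q D t (w t)) ∧
      ∀ f : Fact Q, f ∈ D' ↔ ∃ t ∈ Q.result D, f ∈ w t

/-! ### Machine model: uniform-cost random access machine

Words are natural numbers; the only arithmetic is addition and truncated subtraction, so that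
uniform-cost time is polynomially related to Turing machine time. -/

/-- A state of the machine: registers and memory. -/
structure State where
  reg : ℕ → ℕ
  mem : ℕ → ℕ

/-- Structured programs of the random access machine. -/
inductive Prog : Type
  /-- do nothing -/
  | skip : Prog
  /-- `reg r := c` -/
  | const (r c : ℕ) : Prog
  /-- `reg r := reg a + reg b` -/
  | add (r a b : ℕ) : Prog
  /-- `reg r := reg a - reg b` (truncated at `0`) -/
  | sub (r a b : ℕ) : Prog
  /-- `reg r := mem (reg a)` -/
  | load (r a : ℕ) : Prog
  /-- `mem (reg a) := reg r` -/
  | store (a r : ℕ) : Prog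
  /-- first `p`, then `q` -/
  | seq (p q : Prog) : Prog
  /-- `if reg r = 0 then p else q` -/
  | ifZero (r : ℕ) (p q : Prog) : Prog
  /-- `while reg r ≠ 0 do p` -/
  | loop (r : ℕ) (p : Prog) : Prog

/-- Assignment to a register. -/
def State.setReg (s : State) (r v : ℕ) : State := ⟨Function.update s.reg r v, s.mem⟩

/-- Assignment to a memory cell. -/
def State.setMem (s : State) (a v : ℕ) : State := ⟨s.reg, Function.update s.mem a v⟩

/-- `Run p s s' n`: started in the state `s`, the program `p` halts in the state `s'` after exactly
`n` steps. Every elementary instruction and every test costs one step. -/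
inductive Run : Prog → State → State → ℕ → Prop
  | skip (s : State) : Run Prog.skip s s 1
  | const (r c : ℕ) (s : State) : Run (Prog.const r c) s (s.setReg r c) 1
  | add (r a b : ℕ) (s : State) : Run (Prog.add r a b) s (s.setReg r (s.reg a + s.reg b)) 1
  | sub (r a b : ℕ) (s : State) : Run (Prog.sub r a b) s (s.setReg r (s.reg a - s.reg b)) 1
  | load (r a : ℕ) (s : State) : Run (Prog.load r a) s (s.setReg r (s.mem (s.reg a))) 1
  | store (a r : ℕ) (s : State) : Run (Prog.store a r) s (s.setMem (s.reg a) (s.reg r)) 1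
  | seq {p q : Prog} {s s₁ s₂ : State} {n₁ n₂ : ℕ} :
      Run p s s₁ n₁ → Run q s₁ s₂ n₂ → Run (Prog.seq p q) s s₂ (n₁ + n₂)
  | ifZero_true {r : ℕ} {p q : Prog} {s s' : State} {n : ℕ} :
      s.reg r = 0 → Run p s s' n → Run (Prog.ifZero r p q) s s' (n + 1)
  | ifZero_false {r : ℕ} {p q : Prog} {s s' : State} {n : ℕ} :
      s.reg r ≠ 0 → Run q s s' n → Run (Prog.ifZero r p q) s s' (n + 1)
  | loop_done {r : ℕ} {p : Prog} {s : State} : s.reg r = 0 → Run (Prog.loop r p) s s 1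
  | loop_step {r : ℕ} {p : Prog} {s s₁ s₂ : State} {n₁ n₂ : ℕ} :
      s.reg r ≠ 0 → Run p s s₁ n₁ → Run (Prog.loop r p) s₁ s₂ n₂ →
        Run (Prog.loop r p) s s₂ (n₁ + n₂ + 1)

/-- The state `s` holds the database `D`: register `0` contains `|D|`, and the memory from address
`0` on contains the facts of `D`, listed without repetition in some order. Each fact is a record of
`1 + numAttr` words: the number of its relation, then for each attribute `A` one word, which is the
value of the tuple at `A` if `A` is an attribute of the relation, and arbitrary otherwise. The other
registers and memory cells are arbitrary. -/
def Holds (Q : CQ) (s : State) (D : Database Q) : Prop :=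
  ∃ l : List (Fact Q), l.Nodup ∧ l.toFinset = D ∧ s.reg 0 = l.length ∧
    ∀ (j : ℕ) (hj : j < l.length),
      s.mem (j * (1 + Q.numAttr)) = (l[j].1 : ℕ) ∧
        ∀ A : {A : Fin Q.numAttr // A ∈ Q.attr l[j].1},
          s.mem (j * (1 + Q.numAttr) + 1 + (A.1 : ℕ)) = l[j].2 A

/-- The search problem "given `D`, find some `D'` with `Spec D D'`" is solved by a program of the
random access machine in a number of steps that is polynomial in `|D|`. The program may depend on
the query (data complexity), but on nothing else. -/
def SolvableInPolyTime (Q : CQ) (Spec : Database Q → Database Q → Prop) : Prop :=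
  ∃ (P : Prog) (p : Polynomial ℕ), ∀ (D : Database Q) (s : State), Holds Q s D →
    ∃ (s' : State) (n : ℕ) (D' : Database Q),
      Run P s s' n ∧ n ≤ p.eval D.card ∧ Holds Q s' D' ∧ Spec D D'

/-- `SWP` is `θ`-approximable for `Q`, where the ratio `θ` is a function of `N = |D|`. -/
def IsApproximable (Q : CQ) (θ : ℕ → ℝ) : Prop :=
  SolvableInPolyTime Q fun D D' => IsApproxSolution Q (θ D.card) D D'

/-- The ratio `|rels(Q)| · N^(1 - 1/ρ*)`. -/
noncomputable def CQ.ratio (Q : CQ) (N : ℕ) : ℝ :=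
  (Q.numRel : ℝ) * (N : ℝ) ^ (1 - 1 / Q.fracEdgeCoverNumber)

end SWP

/-!
Every smallest witness for a single query result consists of exactly `m` facts, namely those of one
tuple of the natural join. A union `D'` of such witnesses therefore has at most `m · |Q(D)|` facts.
By the bound of Atserias, Grohe and Marx, any witness `D*` has `|Q(D)| = |Q(D*)| ≤ |D*| ^ ρ*`, and
hence `|D'| ≤ m · min (N, |Q(D)|) ≤ m · N ^ (1 - 1/ρ*) · |D*|`.

For the algorithm, start with `D` and delete one fact after the other whenever it is redundant, that
is, whenever the query result does not change. In the remaining witness no fact is redundant, so it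
is the union of any choice of smallest witnesses inside it. Redundancy is a first-order property of
the list of facts, with quantifiers over `m`-tuples of records, and nested loops decide it.
-/

namespace SWP

theorem le_rpow_sInf {x c : ℝ} {S : Set ℝ} (hc : 1 ≤ c) (hS : S.Nonempty)
    (h : ∀ r ∈ S, x ≤ c ^ r) : x ≤ c ^ sInf S := by
  rcases hc.eq_or_lt with rfl | hc
  · simpa using h _ hS.choose_spec
  rcases le_or_gt x 0 with hx | hx
  · exact hx.trans (Real.rpow_nonneg (one_pos.trans hc).le _)
  rw [← Real.logb_le_iff_le_rpow hc hx]
  exact le_csInf hS fun r hr => (Real.logb_le_iff_le_rpow hc hx).2 (h r hr)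

theorem min_le_rpow_mul {n k d ρ : ℝ} (hn : 0 ≤ n) (hk : 0 ≤ k) (hd : 0 ≤ d) (hρ : 1 ≤ ρ)
    (h : k ≤ d ^ ρ) : min n k ≤ n ^ (1 - 1 / ρ) * d := by
  have hρ₀ : 0 < ρ := one_pos.trans_le hρ
  have hα : 0 ≤ 1 - 1 / ρ := sub_nonneg.2 ((div_le_one hρ₀).2 hρ)
  have hmin : 0 ≤ min n k := le_min hn hk
  have hroot : min n k ^ (1 / ρ) ≤ d := by
    rw [one_div, Real.rpow_inv_le_iff_of_pos hmin hd hρ₀]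
    exact (min_le_right n k).trans h
  calc min n k = min n k ^ (1 - 1 / ρ) * min n k ^ (1 / ρ) := by
        rw [← Real.rpow_add' hmin (by simp), sub_add_cancel, Real.rpow_one]
    _ ≤ n ^ (1 - 1 / ρ) * d := by
        gcongr
        exact min_le_left n k

/-! ### The bound of Atserias, Grohe and Marx -/

section AGM

open Finset

variable {ι κ α : Type*}

theorem prod_rpow_le_sum_div_mul {I : Finset ι} {W y : ι → ℝ} (hW : ∀ i ∈ I, 0 ≤ W i)
    (hI : 1 ≤ ∑ i ∈ I, W i) (hy₀ : ∀ i ∈ I, 0 ≤ y i) (hy₁ : ∀ i ∈ I, y i ≤ 1) :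
    ∏ i ∈ I, y i ^ W i ≤ ∑ i ∈ I, W i / (∑ j ∈ I, W j) * y i := by
  have hσ : 0 < ∑ i ∈ I, W i := one_pos.trans_le hI
  calc ∏ i ∈ I, y i ^ W i
      ≤ ∏ i ∈ I, y i ^ (W i / ∑ j ∈ I, W j) := by
        refine prod_le_prod (fun i hi => Real.rpow_nonneg (hy₀ i hi) _) fun i hi => ?_
        refine Real.rpow_le_rpow_of_exponent_ge_of_imp (hy₀ i hi) (hy₁ i hi)
          (div_le_self (hW i hi) hI) fun _ h => ?_
        simpa [hσ.ne'] using h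
    _ ≤ ∑ i ∈ I, W i / (∑ j ∈ I, W j) * y i :=
        Real.geom_mean_le_arith_mean_weighted I _ _ (fun i hi => div_nonneg (hW i hi) hσ.le)
          (by rw [← sum_div, div_self hσ.ne']) hy₀

/-- Dividing each `x i` by its sum reduces the inequality to `∑ a ∈ s, ∏ i ∈ I, x i a ^ W i ≤ 1`,
which follows from the inequality of arithmetic and geometric means at each point of `s`. -/
theorem sum_prod_rpow_le_prod_sum_rpow (s : Finset κ) {I : Finset ι} {W : ι → ℝ} {x : ι → κ → ℝ}
    (hW : ∀ i ∈ I, 0 ≤ W i) (hI : 1 ≤ ∑ i ∈ I, W i) (hx : ∀ i ∈ I, ∀ a ∈ s, 0 ≤ x i a) :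
    ∑ a ∈ s, ∏ i ∈ I, x i a ^ W i ≤ ∏ i ∈ I, (∑ a ∈ s, x i a) ^ W i := by
  set X : ι → ℝ := fun i => ∑ a ∈ s, x i a with hX
  have hσ : 0 < ∑ i ∈ I, W i := one_pos.trans_le hI
  have hX₀ : ∀ i ∈ I, 0 ≤ X i := fun i hi => sum_nonneg (hx i hi)
  have hxX : ∀ i ∈ I, ∀ a ∈ s, x i a ≤ X i := fun i hi a ha => single_le_sum (hx i hi) ha
  have factor : ∀ i ∈ I, ∀ a ∈ s, x i a ^ W i = (x i a / X i) ^ W i * X i ^ W i := by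
    intro i hi a ha
    rw [← Real.mul_rpow (div_nonneg (hx i hi a ha) (hX₀ i hi)) (hX₀ i hi),
      div_mul_cancel_of_imp fun h => le_antisymm (h ▸ hxX i hi a ha) (hx i hi a ha)]
  have normalised : ∑ a ∈ s, ∏ i ∈ I, (x i a / X i) ^ W i ≤ 1 :=
    calc ∑ a ∈ s, ∏ i ∈ I, (x i a / X i) ^ W i
        ≤ ∑ a ∈ s, ∑ i ∈ I, W i / (∑ j ∈ I, W j) * (x i a / X i) := sum_le_sum fun a ha =>
          prod_rpow_le_sum_div_mul hW hI (fun i hi => div_nonneg (hx i hi a ha) (hX₀ i hi))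
            fun i hi => div_le_one_of_le₀ (hxX i hi a ha) (hX₀ i hi)
      _ = ∑ i ∈ I, W i / (∑ j ∈ I, W j) * (X i / X i) := by
          rw [sum_comm]
          simp only [hX, sum_div, mul_sum]
      _ ≤ ∑ i ∈ I, W i / ∑ j ∈ I, W j := sum_le_sum fun i hi =>
          mul_le_of_le_one_right (div_nonneg (hW i hi) hσ.le) (div_self_le_one _)
      _ = 1 := by rw [← sum_div, div_self hσ.ne']
  calc ∑ a ∈ s, ∏ i ∈ I, x i a ^ W i
      = (∑ a ∈ s, ∏ i ∈ I, (x i a / X i) ^ W i) * ∏ i ∈ I, X i ^ W i := by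
        rw [sum_mul]
        refine sum_congr rfl fun a ha => ?_
        rw [← prod_mul_distrib]
        exact prod_congr rfl fun i hi => factor i hi a ha
    _ ≤ ∏ i ∈ I, X i ^ W i :=
        mul_le_of_le_one_left (prod_nonneg fun i hi => Real.rpow_nonneg (hX₀ i hi) _) normalised

theorem card_image_le_card_image [DecidableEq ι] [DecidableEq κ] {F : Finset α} {f : α → ι}
    {g : α → κ} (h : ∀ t ∈ F, ∀ u ∈ F, g t = g u → f t = f u) :
    (F.image f).card ≤ (F.image g).card := by
  obtain ⟨F', hF', hinj, himage⟩ :=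
    exists_subset_injOn_image_eq_of_surjOn (f := f) F (F.image f) (by simp [Set.surjOn_image])
  calc (F.image f).card = F'.card := by rw [← himage, card_image_of_injOn hinj]
    _ = (F'.image g).card := (card_image_of_injOn fun t ht u hu htu =>
        hinj ht hu (h t (hF' ht) u (hF' hu) htu)).symm
    _ ≤ (F.image g).card := card_le_card (image_subset_image hF')

theorem card_image_congr [DecidableEq ι] [DecidableEq κ] {F : Finset α} {f : α → ι}
    {g : α → κ} (h : ∀ t ∈ F, ∀ u ∈ F, f t = f u ↔ g t = g u) :
    (F.image f).card = (F.image g).card :=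
  le_antisymm (card_image_le_card_image fun t ht u hu => (h t ht u hu).2)
    (card_image_le_card_image fun t ht u hu => (h t ht u hu).1)

theorem card_image_prodMk [DecidableEq ι] [DecidableEq κ] (F : Finset α) (f : α → ι) (g : α → κ) :
    (F.image fun t => (f t, g t)).card = ∑ a ∈ F.image f, ((F.filter (f · = a)).image g).card := by
  rw [card_eq_sum_card_fiberwise (f := Prod.fst) (t := F.image f) fun x hx => by
    obtain ⟨t, ht, rfl⟩ := mem_image.1 hx
    exact mem_image_of_mem f ht]
  refine sum_congr rfl fun a _ => ?_
  rw [filter_image]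
  refine card_image_congr fun t ht u hu => ?_
  simp only [mem_filter] at ht hu
  simp [ht.2, hu.2]

variable {π : α → Type*} [∀ a, DecidableEq (π a)]

/-- The number of distinct restrictions of the functions in `F` to the set `S` of coordinates. -/
def projCard (F : Finset (∀ a, π a)) (S : Finset α) : ℕ := (F.image S.restrict).card

theorem projCard_le_of_subset {F F' : Finset (∀ a, π a)} (h : F ⊆ F') (S : Finset α) :
    projCard F S ≤ projCard F' S :=
  card_le_card (image_subset_image h)

theorem projCard_empty {F : Finset (∀ a, π a)} (hF : F.Nonempty) : projCard F ∅ = 1 := by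
  rw [projCard, card_eq_one]
  exact ⟨_, (image_nonempty.2 hF).eq_singleton_default⟩

variable [DecidableEq α]

theorem projCard_insert (F : Finset (∀ a, π a)) (A : α) (S : Finset α) :
    projCard F (insert A S) = ∑ a ∈ F.image (· A), projCard (F.filter (· A = a)) S := by
  refine (card_image_congr fun t _ u _ => ?_).trans (card_image_prodMk F (· A) S.restrict)
  simp [funext_iff]

theorem sum_prod_projCard_filter_rpow_le [Fintype ι] {X : ι → Finset α} {W : ι → ℝ}
    (hW : ∀ i, 0 ≤ W i) (F : Finset (∀ a, π a)) (S : Finset α) {A : α}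
    (hA : 1 ≤ ∑ i with A ∈ X i, W i) :
    ∑ a ∈ F.image (· A), ∏ i, (projCard (F.filter (· A = a)) (X i ∩ S) : ℝ) ^ W i ≤
      ∏ i, (projCard F (X i ∩ insert A S) : ℝ) ^ W i := by
  have fixed : ∀ i, A ∉ X i → ∀ a,
      projCard (F.filter (· A = a)) (X i ∩ S) ≤ projCard F (X i ∩ insert A S) := fun i hi a =>
    inter_insert_of_notMem hi ▸ projCard_le_of_subset (filter_subset _ _) _
  have summed : ∀ i, A ∈ X i → (projCard F (X i ∩ insert A S) : ℝ) =
      ∑ a ∈ F.image (· A), (projCard (F.filter (· A = a)) (X i ∩ S) : ℝ) := fun i hi => by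
    rw [inter_insert_of_mem hi, projCard_insert, Nat.cast_sum]
  calc ∑ a ∈ F.image (· A), ∏ i, (projCard (F.filter (· A = a)) (X i ∩ S) : ℝ) ^ W i
      ≤ ∑ a ∈ F.image (· A),
          (∏ i with A ∈ X i, (projCard (F.filter (· A = a)) (X i ∩ S) : ℝ) ^ W i) *
            ∏ i with A ∉ X i, (projCard F (X i ∩ insert A S) : ℝ) ^ W i := by
        refine sum_le_sum fun a _ => ?_
        rw [← prod_filter_mul_prod_filter_not univ (A ∈ X ·)]
        gcongr with i hi
        · exact hW i
        · exact fixed i (mem_filter.1 hi).2 a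
    _ ≤ (∏ i with A ∈ X i, (projCard F (X i ∩ insert A S) : ℝ) ^ W i) *
          ∏ i with A ∉ X i, (projCard F (X i ∩ insert A S) : ℝ) ^ W i := by
        rw [← sum_mul]
        gcongr
        refine (sum_prod_rpow_le_prod_sum_rpow _ (fun i _ => hW i) hA
          fun i _ a _ => Nat.cast_nonneg _).trans_eq (prod_congr rfl fun i hi => ?_)
        rw [summed i (mem_filter.1 hi).2]
    _ = ∏ i, (projCard F (X i ∩ insert A S) : ℝ) ^ W i :=
        prod_filter_mul_prod_filter_not univ (A ∈ X ·) _

theorem projCard_le_prod_rpow [Fintype ι] {X : ι → Finset α} {W : ι → ℝ} (hW : ∀ i, 0 ≤ W i)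
    {S : Finset α} (hS : ∀ A ∈ S, 1 ≤ ∑ i with A ∈ X i, W i) (F : Finset (∀ a, π a)) :
    (projCard F S : ℝ) ≤ ∏ i, (projCard F (X i ∩ S) : ℝ) ^ W i := by
  induction S using Finset.induction_on generalizing F with
  | empty =>
    rcases F.eq_empty_or_nonempty with rfl | hF
    · simpa [projCard] using prod_nonneg fun i _ => Real.rpow_nonneg le_rfl (W i)
    · simp [projCard_empty hF]
  | insert A S _ ih =>
    calc (projCard F (insert A S) : ℝ)
        = ∑ a ∈ F.image (· A), (projCard (F.filter (· A = a)) S : ℝ) := by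
          rw [projCard_insert, Nat.cast_sum]
      _ ≤ ∑ a ∈ F.image (· A), ∏ i, (projCard (F.filter (· A = a)) (X i ∩ S) : ℝ) ^ W i :=
          sum_le_sum fun a _ => ih (fun B hB => hS B (mem_insert_of_mem hB)) _
      _ ≤ ∏ i, (projCard F (X i ∩ insert A S) : ℝ) ^ W i :=
          sum_prod_projCard_filter_rpow_le hW F S (hS A (mem_insert_self A S))

end AGM

/-! ### Query results and smallest witnesses -/

section Witness

variable {Q : CQ} {D D' : Database Q}

/-- The natural join of all relations of `D`, a set of tuples over all attributes. -/
def CQ.join (Q : CQ) (D : Database Q) : Set (Fin Q.numAttr → ℕ) :=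
  {t | ∀ i, (⟨i, proj (Q.attr i) t⟩ : Fact Q) ∈ D}

theorem CQ.result_eq_image_join : Q.result D = proj Q.head '' Q.join D := by
  ext u
  simp only [CQ.result, CQ.join, Set.mem_image, Set.mem_ofPred_eq, eq_comm]

theorem CQ.result_mono : Monotone Q.result := by
  rintro D D' h _ ⟨t, ht, rfl⟩
  exact ⟨t, fun i => h (ht i), rfl⟩

theorem CQ.finite_join (D : Database Q) : (Q.join D).Finite := by
  let facts : Q.join D → Fin Q.numRel → D := fun t i => ⟨_, t.2 i⟩
  refine Set.finite_coe_iff.1 (Finite.of_injective facts fun t u htu => Subtype.ext ?_)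
  funext A
  obtain ⟨i, hi⟩ := Q.covered A
  have : proj (Q.attr i) t.1 = proj (Q.attr i) u.1 :=
    sigma_mk_injective (β := fun i => Tuple (Q.attr i)) (congrArg Subtype.val (congrFun htu i))
  exact congrFun this ⟨A, hi⟩

theorem CQ.finite_result (D : Database Q) : (Q.result D).Finite :=
  CQ.result_eq_image_join ▸ (CQ.finite_join D).image _

theorem projCard_attr_le {F : Finset (Fin Q.numAttr → ℕ)} (hF : ↑F ⊆ Q.join D)
    (i : Fin Q.numRel) : projCard F (Q.attr i) ≤ D.card := by
  refine Finset.card_le_card_of_injOn (fun u => (⟨i, u⟩ : Fact Q)) (fun u hu => ?_)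
    (sigma_mk_injective (β := fun i => Tuple (Q.attr i))).injOn
  obtain ⟨t, ht, rfl⟩ := Finset.mem_image.1 hu
  exact hF ht i

theorem CQ.ncard_join_le_rpow_sum {W : Fin Q.numRel → ℝ} (hW : Q.IsFracEdgeCovering W)
    (D : Database Q) : ((Q.join D).ncard : ℝ) ≤ (D.card : ℝ) ^ ∑ i, W i := by
  set F := (CQ.finite_join D).toFinset with hF
  have hFD : ↑F ⊆ Q.join D := by simp [hF]
  have huniv : projCard F Finset.univ = F.card :=
    Finset.card_image_of_injective _ fun t u htu => funext fun A =>
      congrFun htu ⟨A, Finset.mem_univ A⟩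
  calc ((Q.join D).ncard : ℝ) = projCard F Finset.univ := by
        rw [huniv, Set.ncard_eq_toFinset_card _ (CQ.finite_join D)]
    _ ≤ ∏ i, (projCard F (Q.attr i ∩ Finset.univ) : ℝ) ^ W i :=
        projCard_le_prod_rpow (fun i => (hW.1 i).1) (fun A _ => hW.2 A) F
    _ ≤ ∏ i, (D.card : ℝ) ^ W i := by
        gcongr with i
        · exact (hW.1 i).1
        · rw [Finset.inter_univ]
          exact projCard_attr_le hFD i
    _ = (D.card : ℝ) ^ ∑ i, W i :=
        (Real.rpow_sum_of_nonneg (Nat.cast_nonneg _) fun i _ => (hW.1 i).1).symm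

theorem CQ.numRel_pos (hQ : 0 < Q.numAttr) : 0 < Q.numRel :=
  let ⟨i, _⟩ := Q.covered ⟨0, hQ⟩
  i.pos

theorem CQ.isFracEdgeCovering_one : Q.IsFracEdgeCovering 1 := by
  refine ⟨fun i => by simp, fun A => ?_⟩
  obtain ⟨i, hi⟩ := Q.covered A
  simp only [Pi.one_apply, Finset.sum_const, nsmul_eq_mul, mul_one]
  exact_mod_cast Finset.card_pos.2 ⟨i, by simp [hi]⟩

theorem CQ.one_le_fracEdgeCoverNumber (hQ : 0 < Q.numAttr) : 1 ≤ Q.fracEdgeCoverNumber := by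
  refine le_csInf ⟨_, 1, CQ.isFracEdgeCovering_one, rfl⟩ ?_
  rintro _ ⟨W, hW, rfl⟩
  exact (hW.2 ⟨0, hQ⟩).trans
    (Finset.sum_le_sum_of_subset_of_nonneg (Finset.subset_univ _) fun i _ _ => (hW.1 i).1)

theorem CQ.ncard_result_le_rpow (hQ : 0 < Q.numAttr) (D : Database Q) :
    ((Q.result D).ncard : ℝ) ≤ (D.card : ℝ) ^ Q.fracEdgeCoverNumber := by
  have hcard : ((Q.result D).ncard : ℝ) ≤ (Q.join D).ncard := by
    rw [CQ.result_eq_image_join]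
    exact_mod_cast Set.ncard_image_le (CQ.finite_join D)
  refine hcard.trans ?_
  rcases D.eq_empty_or_nonempty with rfl | hD
  · have hempty : Q.join ∅ = ∅ :=
      Set.eq_empty_of_forall_notMem fun t ht => by simpa using ht ⟨0, CQ.numRel_pos hQ⟩
    simpa [hempty] using Real.rpow_nonneg le_rfl _
  · refine le_rpow_sInf (by exact_mod_cast hD.card_pos) ⟨_, 1, CQ.isFracEdgeCovering_one, rfl⟩ ?_
    rintro _ ⟨W, hW, rfl⟩
    exact CQ.ncard_join_le_rpow_sum hW D

/-- The facts that make up a tuple over all attributes. -/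
def CQ.factsOf (Q : CQ) (t : Fin Q.numAttr → ℕ) : Database Q :=
  Finset.univ.map ⟨fun i => (⟨i, proj (Q.attr i) t⟩ : Fact Q), fun _ _ h => congrArg Sigma.fst h⟩

theorem CQ.card_factsOf (t : Fin Q.numAttr → ℕ) : (Q.factsOf t).card = Q.numRel := by
  simp [CQ.factsOf]

theorem CQ.factsOf_subset_iff {t : Fin Q.numAttr → ℕ} : Q.factsOf t ⊆ D ↔ t ∈ Q.join D := by
  simp only [CQ.factsOf, Finset.subset_iff, Finset.mem_map, Finset.mem_univ, true_and,
    forall_exists_index, forall_apply_eq_imp_iff]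
  rfl

theorem CQ.mem_result_iff {u : Tuple Q.head} :
    u ∈ Q.result D ↔ ∃ t, Q.factsOf t ⊆ D ∧ proj Q.head t = u := by
  simp only [CQ.factsOf_subset_iff, CQ.result_eq_image_join, Set.mem_image]

theorem CQ.numRel_le_card {u : Tuple Q.head} (h : u ∈ Q.result D) : Q.numRel ≤ D.card := by
  obtain ⟨t, ht, -⟩ := CQ.mem_result_iff.1 h
  exact CQ.card_factsOf t ▸ Finset.card_le_card ht

theorem isSmallestWitnessFor_factsOf {t : Fin Q.numAttr → ℕ} (h : Q.factsOf t ⊆ D) :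
    IsSmallestWitnessFor Q D (proj Q.head t) (Q.factsOf t) :=
  ⟨⟨h, CQ.mem_result_iff.2 ⟨t, subset_rfl, rfl⟩⟩, fun _ _ h' =>
    (CQ.card_factsOf t).trans_le (CQ.numRel_le_card h')⟩

theorem IsSmallestWitnessFor.card_eq {u : Tuple Q.head} (h : IsSmallestWitnessFor Q D u D') :
    D'.card = Q.numRel := by
  obtain ⟨t, ht, rfl⟩ := CQ.mem_result_iff.1 (CQ.result_mono h.1.1 h.1.2)
  refine le_antisymm ?_ (CQ.numRel_le_card h.1.2)
  exact (h.2 _ ht (CQ.mem_result_iff.2 ⟨t, subset_rfl, rfl⟩)).trans_eq (CQ.card_factsOf t)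

theorem IsUnionOfSmallestWitnesses.isWitness (h : IsUnionOfSmallestWitnesses Q D D') :
    IsWitness Q D D' := by
  obtain ⟨w, hw, hD'⟩ := h
  have hsub : D' ⊆ D := fun f hf => by
    obtain ⟨t, ht, hf⟩ := (hD' f).1 hf
    exact (hw t ht).1.1 hf
  exact ⟨hsub, (CQ.result_mono hsub).antisymm fun t ht =>
    CQ.result_mono (fun f hf => (hD' f).2 ⟨t, ht, hf⟩) (hw t ht).1.2⟩

theorem IsUnionOfSmallestWitnesses.card_le (h : IsUnionOfSmallestWitnesses Q D D') :
    D'.card ≤ (Q.result D).ncard * Q.numRel := by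
  classical
  obtain ⟨w, hw, hD'⟩ := h
  have hunion : D' = (CQ.finite_result D).toFinset.biUnion w := by
    ext f
    simp [hD']
  rw [hunion, Set.ncard_eq_toFinset_card _ (CQ.finite_result D)]
  exact Finset.card_biUnion_le_card_mul _ _ _ fun u hu => (hw u (by simpa using hu)).card_eq.le

theorem isUnionOfSmallestWitnesses_of_minimal (h : IsWitness Q D D')
    (hmin : ∀ f ∈ D', Q.result (D'.erase f) ≠ Q.result D') :
    IsUnionOfSmallestWitnesses Q D D' := by
  have hfacts : ∀ u, ∃ E : Database Q, u ∈ Q.result D →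
      E ⊆ D' ∧ u ∈ Q.result E ∧ IsSmallestWitnessFor Q D u E := by
    intro u
    by_cases hu : u ∈ Q.result D
    · obtain ⟨t, ht, rfl⟩ := CQ.mem_result_iff.1 (h.2 ▸ hu)
      have := isSmallestWitnessFor_factsOf (ht.trans h.1)
      exact ⟨Q.factsOf t, fun _ => ⟨ht, this.1.2, this⟩⟩
    · exact ⟨∅, fun hu' => absurd hu' hu⟩
  choose w hwD' hwu hw using hfacts
  refine ⟨w, hw, fun f => ⟨fun hf => ?_, fun ⟨u, hu, hf⟩ => hwD' u hu hf⟩⟩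
  by_contra! hno
  refine hmin f hf ((CQ.result_mono (Finset.erase_subset _ _)).antisymm fun u hu => ?_)
  rw [h.2] at hu
  exact CQ.result_mono (Finset.subset_erase.2 ⟨hwD' u hu, hno u hu⟩) (hwu u hu)

theorem exists_isSmallestWitness (Q : CQ) (D : Database Q) : ∃ D', IsSmallestWitness Q D D' := by
  classical
  obtain ⟨D', hD', hmin⟩ := Finset.exists_min_image
    (D.powerset.filter fun D' => Q.result D' = Q.result D) Finset.card ⟨D, by simp⟩
  simp only [Finset.mem_filter, Finset.mem_powerset] at hD' hmin
  exact ⟨D', hD', hmin⟩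

theorem IsUnionOfSmallestWitnesses.isApproxSolution (hQ : 0 < Q.numAttr)
    (h : IsUnionOfSmallestWitnesses Q D D') : IsApproxSolution Q (Q.ratio D.card) D D' := by
  obtain ⟨Dopt, hopt⟩ := exists_isSmallestWitness Q D
  refine ⟨h.isWitness, Dopt, hopt, ?_⟩
  have hcard : D'.card ≤ Q.numRel * min D.card (Q.result D).ncard := by
    rw [← Nat.mul_min_mul_left]
    exact le_min ((Finset.card_le_card h.isWitness.1).trans
      (Nat.le_mul_of_pos_left _ (CQ.numRel_pos hQ))) (mul_comm _ Q.numRel ▸ h.card_le)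
  calc (D'.card : ℝ) ≤ Q.numRel * min (D.card : ℝ) (Q.result D).ncard := by exact_mod_cast hcard
    _ ≤ Q.numRel * ((D.card : ℝ) ^ (1 - 1 / Q.fracEdgeCoverNumber) * Dopt.card) := by
        gcongr
        refine min_le_rpow_mul (Nat.cast_nonneg _) (Nat.cast_nonneg _) (Nat.cast_nonneg _)
          (CQ.one_le_fracEdgeCoverNumber hQ) ?_
        rw [← hopt.1.2]
        exact CQ.ncard_result_le_rpow hQ Dopt
    _ = Q.ratio D.card * Dopt.card := by rw [CQ.ratio, mul_assoc]

end Witness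

/-! ### Programming the random access machine -/

section Machine

/-- Total correctness with a time bound: started in `s`, the program `P` halts after at most `T`
steps in a state that satisfies `Post`. -/
def HaltsWithin (P : Prog) (s : State) (T : ℕ) (Post : State → Prop) : Prop :=
  ∃ s' t, Run P s s' t ∧ t ≤ T ∧ Post s'

section HaltsWithin

variable {P P' : Prog} {s s' : State} {r t T T' : ℕ} {Mid Post Post' : State → Prop}

theorem Run.haltsWithin (h : Run P s s' t) (hPost : Post s') : HaltsWithin P s t Post :=
  ⟨s', t, h, le_rfl, hPost⟩

theorem HaltsWithin.mono (h : HaltsWithin P s T Post) (hT : T ≤ T')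
    (hPost : ∀ s', Post s' → Post' s') : HaltsWithin P s T' Post' :=
  let ⟨s', t, hrun, ht, hs'⟩ := h
  ⟨s', t, hrun, ht.trans hT, hPost s' hs'⟩

theorem HaltsWithin.seq (h : HaltsWithin P s T Mid)
    (h' : ∀ s', Mid s' → HaltsWithin P' s' T' Post) : HaltsWithin (.seq P P') s (T + T') Post :=
  let ⟨s₁, _, hrun₁, ht₁, hMid⟩ := h
  let ⟨s₂, _, hrun₂, ht₂, hPost⟩ := h' s₁ hMid
  ⟨s₂, _, .seq hrun₁ hrun₂, Nat.add_le_add ht₁ ht₂, hPost⟩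

theorem Run.seq_haltsWithin (h : Run P s s' t) (h' : HaltsWithin P' s' T Post) :
    HaltsWithin (.seq P P') s (t + T) Post :=
  (h.haltsWithin rfl).seq fun _ hs' => hs' ▸ h'

theorem HaltsWithin.ifZero (h : s.reg r = 0 → HaltsWithin P s T Post)
    (h' : s.reg r ≠ 0 → HaltsWithin P' s T Post) :
    HaltsWithin (.ifZero r P P') s (T + 1) Post := by
  by_cases hr : s.reg r = 0
  · obtain ⟨s', t, hrun, ht, hPost⟩ := h hr
    exact ⟨s', _, .ifZero_true hr hrun, Nat.add_le_add_right ht 1, hPost⟩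
  · obtain ⟨s', t, hrun, ht, hPost⟩ := h' hr
    exact ⟨s', _, .ifZero_false hr hrun, Nat.add_le_add_right ht 1, hPost⟩

theorem HaltsWithin.loop {B : ℕ} {Inv : ℕ → State → Prop} (hzero : ∀ s, Inv 0 s → s.reg r = 0)
    (hstep : ∀ k s, Inv (k + 1) s →
      s.reg r ≠ 0 ∧ HaltsWithin P s B fun s' => ∃ k' ≤ k, Inv k' s')
    {k : ℕ} (hs : Inv k s) : HaltsWithin (.loop r P) s (k * (B + 1) + 1) (Inv 0) := by
  induction k using Nat.strong_induction_on generalizing s with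
  | _ k ih =>
    rcases k with _ | k
    · exact ((Run.loop_done (hzero s hs)).haltsWithin hs).mono (by omega) fun _ => id
    · obtain ⟨hr, s₁, t₁, hrun₁, ht₁, k', hk', hs₁⟩ := hstep k s hs
      obtain ⟨s₂, t₂, hrun₂, ht₂, hs₂⟩ := ih k' (by omega) hs₁
      refine ⟨s₂, _, .loop_step hr hrun₁ hrun₂, ?_, hs₂⟩
      have := Nat.mul_le_mul_right (B + 1) hk'
      rw [Nat.add_mul]
      omega

end HaltsWithin

section State

variable {s s' s'' : State} {k n r v : ℕ}

@[simp] theorem State.reg_setReg : (s.setReg r v).reg = Function.update s.reg r v := rfl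

@[simp] theorem State.mem_setReg : (s.setReg r v).mem = s.mem := rfl

@[simp] theorem State.reg_setMem : (s.setMem r v).reg = s.reg := rfl

@[simp] theorem State.mem_setMem : (s.setMem r v).mem = Function.update s.mem r v := rfl

/-- The values of `n` variables: register `0` holds the number of records, register `1` the end
address of the records, and register `i + 2` the variable `i`. -/
def State.env (n : ℕ) (s : State) : Fin n → ℕ := fun i => s.reg (i + 2)

/-- The states have the same memory and the same registers with number less than `k`. -/
def State.AgreesBelow (k : ℕ) (s s' : State) : Prop := s'.mem = s.mem ∧ ∀ r < k, s'.reg r = s.reg r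

theorem State.AgreesBelow.refl (k : ℕ) (s : State) : s.AgreesBelow k s := ⟨rfl, fun _ _ => rfl⟩

theorem State.AgreesBelow.trans (h : State.AgreesBelow k s s') (h' : State.AgreesBelow k s' s'') :
    State.AgreesBelow k s s'' :=
  ⟨h'.1.trans h.1, fun r hr => (h'.2 r hr).trans (h.2 r hr)⟩

theorem State.AgreesBelow.mono (h : State.AgreesBelow n s s') (hk : k ≤ n) :
    State.AgreesBelow k s s' :=
  ⟨h.1, fun r hr => h.2 r (hr.trans_le hk)⟩

theorem State.AgreesBelow.setReg (h : State.AgreesBelow k s s') (hr : k ≤ r) (v : ℕ) :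
    State.AgreesBelow k s (s'.setReg r v) :=
  ⟨h.1, fun r' hr' => by
    rw [State.reg_setReg, Function.update_of_ne (by omega), h.2 r' hr']⟩

theorem State.AgreesBelow.env_eq (h : State.AgreesBelow (n + 2) s s') : s'.env n = s.env n :=
  funext fun i => h.2 _ (by omega)

theorem State.env_succ (n : ℕ) (s : State) :
    s.env (n + 1) = Fin.snoc (s.env n) (s.reg (n + 2)) :=
  funext fun i => by
    induction i using Fin.lastCases <;> simp [State.env]

end State

/-- Straight-line code can bring the value of `f`, a function of `n` variables and the memory, to
any register above the variables without changing a lower register. -/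
def Evaluable (n : ℕ) (f : (Fin n → ℕ) → (ℕ → ℕ) → ℕ) : Prop :=
  ∀ r, n + 2 ≤ r → ∃ P T, ∀ s,
    HaltsWithin P s T fun s' => s.AgreesBelow r s' ∧ s'.reg r = f (s.env n) s.mem

namespace Evaluable

variable {n : ℕ} {f g : (Fin n → ℕ) → (ℕ → ℕ) → ℕ}

theorem const (c : ℕ) : Evaluable n fun _ _ => c := fun r _ =>
  ⟨.const r c, 1, fun s => (Run.const r c s).haltsWithin
    ⟨(State.AgreesBelow.refl r s).setReg le_rfl _, by simp⟩⟩

theorem var (i : Fin n) : Evaluable n fun e _ => e i := fun r hr =>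
  ⟨.seq (.const r 0) (.add r (i + 2) r), 2, fun s =>
    ((Run.const _ _ _).seq (Run.add _ _ _ _)).haltsWithin
      ⟨((State.AgreesBelow.refl r s).setReg le_rfl _).setReg le_rfl _, by
        simp [State.env, Function.update_of_ne (show (i : ℕ) + 2 ≠ r by omega)]⟩⟩

theorem binary {op : ℕ → ℕ → ℕ} {instr : ℕ → ℕ → ℕ → Prog}
    (hop : ∀ r a b s, Run (instr r a b) s (s.setReg r (op (s.reg a) (s.reg b))) 1)
    (hf : Evaluable n f) (hg : Evaluable n g) :
    Evaluable n fun e mem => op (f e mem) (g e mem) := by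
  intro r hr
  obtain ⟨P, T, hP⟩ := hf r hr
  obtain ⟨P', T', hP'⟩ := hg (r + 1) (by omega)
  refine ⟨.seq P (.seq P' (instr r r (r + 1))), T + (T' + 1), fun s => ?_⟩
  refine (hP s).seq fun s₁ ⟨hs₁, hf⟩ => (hP' s₁).seq fun s₂ ⟨hs₂, hg⟩ =>
    (hop _ _ _ _).haltsWithin
      ⟨(hs₁.trans (hs₂.mono (by omega))).setReg le_rfl _, ?_⟩
  simp [hs₂.2 r (by omega), hf, hg, (hs₁.mono hr).env_eq, hs₁.1]

theorem add (hf : Evaluable n f) (hg : Evaluable n g) :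
    Evaluable n fun e mem => f e mem + g e mem :=
  binary Run.add hf hg

theorem sub (hf : Evaluable n f) (hg : Evaluable n g) :
    Evaluable n fun e mem => f e mem - g e mem :=
  binary Run.sub hf hg

theorem load (hf : Evaluable n f) : Evaluable n fun e mem => mem (f e mem) := by
  intro r hr
  obtain ⟨P, T, hP⟩ := hf r hr
  refine ⟨.seq P (.load r r), T + 1, fun s => (hP s).seq fun s₁ ⟨hs₁, hf⟩ =>
    (Run.load _ _ _).haltsWithin ⟨hs₁.setReg le_rfl _, ?_⟩⟩
  simp [hf, hs₁.1]

end Evaluable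

theorem monotone_polynomial_eval (p : Polynomial ℕ) : Monotone p.eval := fun a b hab => by
  induction p using Polynomial.induction_on' with
  | add p q hp hq => simpa using Nat.add_le_add hp hq
  | monomial n c => simpa using Nat.mul_le_mul_left c (Nat.pow_le_pow_left hab n)

/-- A predicate of the values of `n` variables, the memory and the number of records. -/
abbrev Pred (n : ℕ) : Type := (Fin n → ℕ) → (ℕ → ℕ) → ℕ → Prop

/-- In time polynomial in the number `N` of records of length `w` the machine can decide `φ`,
without changing the memory, the variables and the registers `0` and `1`. The answer appears in the
first register after the variables, and is affirmative if it is not zero. -/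
def PolyDecidable (w n : ℕ) (φ : Pred n) : Prop :=
  ∃ (P : Prog) (p : Polynomial ℕ), ∀ (s : State) (N : ℕ), s.reg 1 = N * w →
    HaltsWithin P s (p.eval N) fun s' =>
      s.AgreesBelow (n + 2) s' ∧ (s'.reg (n + 2) ≠ 0 ↔ φ (s.env n) s.mem N)

namespace PolyDecidable

variable {w n : ℕ} {φ ψ : Pred n} {f g : (Fin n → ℕ) → (ℕ → ℕ) → ℕ}

theorem of_iff (h : PolyDecidable w n φ) (hψ : ∀ e mem N, ψ e mem N ↔ φ e mem N) :
    PolyDecidable w n ψ := by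
  obtain rfl : ψ = φ := funext fun e => funext fun mem => funext fun N => propext (hψ e mem N)
  exact h

theorem ne_zero (hf : Evaluable n f) : PolyDecidable w n fun e mem _ => f e mem ≠ 0 := by
  obtain ⟨P, T, hP⟩ := hf (n + 2) le_rfl
  refine ⟨P, Polynomial.C T, fun s N _ => (hP s).mono (by simp) fun s' ⟨hs', hf⟩ => ⟨hs', ?_⟩⟩
  rw [hf]

protected theorem true : PolyDecidable w n fun _ _ _ => True :=
  (ne_zero (.const 1)).of_iff fun _ _ _ => by simp

protected theorem not (h : PolyDecidable w n φ) :
    PolyDecidable w n fun e mem N => ¬ φ e mem N := by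
  obtain ⟨P, p, hP⟩ := h
  refine ⟨.seq P (.ifZero (n + 2) (.const (n + 2) 1) (.const (n + 2) 0)), p + 2, fun s N hN => ?_⟩
  refine (((hP s N hN).seq (T' := 2) fun s₁ ⟨hs₁, hφ⟩ => .ifZero (fun h0 => ?_) fun h0 => ?_).mono
    (by simp) fun _ => id)
  · exact (Run.const _ _ _).haltsWithin ⟨hs₁.setReg le_rfl _, by simp [← hφ, h0]⟩
  · exact (Run.const _ _ _).haltsWithin ⟨hs₁.setReg le_rfl _, by simp [← hφ, h0]⟩

theorem eq (hf : Evaluable n f) (hg : Evaluable n g) :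
    PolyDecidable w n fun e mem _ => f e mem = g e mem :=
  (ne_zero ((hf.sub hg).add (hg.sub hf))).not.of_iff fun e mem _ => by omega

protected theorem and (h : PolyDecidable w n φ) (h' : PolyDecidable w n ψ) :
    PolyDecidable w n fun e mem N => φ e mem N ∧ ψ e mem N := by
  obtain ⟨P, p, hP⟩ := h
  obtain ⟨P', p', hP'⟩ := h'
  refine ⟨.seq P (.ifZero (n + 2) .skip P'), p + (p' + 1 + 1), fun s N hN => ?_⟩
  refine ((hP s N hN).seq (T' := p'.eval N + 1 + 1) fun s₁ ⟨hs₁, hφ⟩ =>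
    .ifZero (fun h0 => ?_) fun h0 => ?_).mono (by simp) fun _ => id
  · exact ((Run.skip s₁).haltsWithin ⟨hs₁, by simp [← hφ, h0]⟩).mono (by omega) fun _ => id
  · refine (hP' s₁ N ((hs₁.2 1 (by omega)).trans hN)).mono (by omega) fun s₂ ⟨hs₂, hψ⟩ =>
      ⟨hs₁.trans hs₂, ?_⟩
    simp only [hψ, hs₁.env_eq, hs₁.1, hφ.1 h0, true_and]

protected theorem imp (h : PolyDecidable w n φ) (h' : PolyDecidable w n ψ) :
    PolyDecidable w n fun e mem N => φ e mem N → ψ e mem N :=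
  (h.and h'.not).not.of_iff fun _ _ _ => by simp

theorem forall_finite {ι : Type*} [Finite ι] {φ : ι → Pred n}
    (h : ∀ i, PolyDecidable w n (φ i)) : PolyDecidable w n fun e mem N => ∀ i, φ i e mem N := by
  classical
  have := Fintype.ofFinite ι
  have hS : ∀ S : Finset ι, PolyDecidable w n fun e mem N => ∀ i ∈ S, φ i e mem N := by
    intro S
    induction S using Finset.induction_on with
    | empty => exact PolyDecidable.true.of_iff fun _ _ _ => by simp
    | insert i S _ ih => exact ((h i).and ih).of_iff fun _ _ _ => by simp
  exact (hS Finset.univ).of_iff fun _ _ _ => by simp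

/-- The body of the loop that decides `∀ j : Fin N, φ (Fin.snoc e (j * w)) mem N` by running through
the records from the last to the first, where `P` decides `φ`. Register `n + 2` is the address of
the record; setting it to zero after a negative answer terminates the loop. -/
def scanBody (w n : ℕ) (P : Prog) : Prog :=
  .seq (.const (n + 3) w) <| .seq (.sub (n + 2) (n + 2) (n + 3)) <| .seq P <|
    .ifZero (n + 3) (.const (n + 2) 0) .skip

/-- The invariant of that loop, which was entered in the state `s`: the records from `k` on have
been visited. -/
structure ScanInv (w n : ℕ) (s : State) {N : ℕ} (ψ : Fin N → Prop) (k : ℕ) (s' : State) :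
    Prop where
  agrees : s.AgreesBelow (n + 2) s'
  cursor : s'.reg (n + 2) = k * w
  le : k ≤ N
  answer : s'.reg (n + 3) ≠ 0 ↔ ∀ j : Fin N, k ≤ j → ψ j
  eq_zero : s'.reg (n + 3) = 0 → k = 0

theorem ScanInv.step {B N k : ℕ} {s s₁ : State} {P : Prog} {ψ : Fin N → Prop} (hw : 0 < w)
    (hP : ∀ j : Fin N, ∀ s', s.AgreesBelow (n + 2) s' → s'.reg (n + 2) = j * w →
      HaltsWithin P s' B fun s'' => s'.AgreesBelow (n + 3) s'' ∧ (s''.reg (n + 3) ≠ 0 ↔ ψ j))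
    (h : ScanInv w n s ψ (k + 1) s₁) :
    s₁.reg (n + 2) ≠ 0 ∧
      HaltsWithin (scanBody w n P) s₁ (B + 4) fun s' => ∃ k' ≤ k, ScanInv w n s ψ k' s' := by
  have hcursor : s₁.reg (n + 2) - w = k * w := by rw [h.cursor, Nat.succ_mul, Nat.add_sub_cancel]
  have hall : ∀ j : Fin N, k + 1 ≤ j → ψ j := h.answer.1 fun h0 => by simpa using h.eq_zero h0
  let c : Fin N := ⟨k, h.le⟩
  have hψ : (∀ j : Fin N, k ≤ j → ψ j) ↔ ψ c := by
    refine ⟨fun hk => hk c le_rfl, fun hc j hj => ?_⟩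
    rcases hj.eq_or_lt with hj | hj
    · exact (Fin.ext hj : c = j) ▸ hc
    · exact hall j hj
  refine ⟨by rw [h.cursor]; positivity, ?_⟩
  refine ((Run.const _ _ _).seq_haltsWithin <| (Run.sub _ _ _ _).seq_haltsWithin <|
    HaltsWithin.seq (hP c _ ((h.agrees.setReg (by omega) _).setReg le_rfl _) (by simp [hcursor, c]))
      (T' := 2) fun s₂ ⟨hs₂, hanswer⟩ => ?_).mono (by omega) fun _ => id
  have hagrees : s.AgreesBelow (n + 2) s₂ :=
    ((h.agrees.setReg (by omega) _).setReg le_rfl _).trans (hs₂.mono (by omega))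
  have hreg : s₂.reg (n + 2) = k * w := by simp [hs₂.2 (n + 2) (by omega), hcursor]
  refine .ifZero (fun h0 => (Run.const _ _ _).haltsWithin ⟨0, Nat.zero_le k, ?_⟩) fun h0 =>
    (Run.skip _).haltsWithin ⟨k, le_rfl, hagrees, hreg, c.2.le, hanswer.trans hψ.symm, by simp [h0]⟩
  exact ⟨hagrees.setReg le_rfl _, by simp, Nat.zero_le N,
    by simpa [h0] using ⟨c, by simpa [h0] using hanswer⟩, fun _ => rfl⟩

theorem forall_record {φ : Pred (n + 1)} (hw : 0 < w) (h : PolyDecidable w (n + 1) φ) :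
    PolyDecidable w n fun e mem N => ∀ j : Fin N, φ (Fin.snoc e (j * w : ℕ)) mem N := by
  obtain ⟨P, p, hP⟩ := h
  refine ⟨.seq (.const (n + 3) 0) <| .seq (.add (n + 2) 1 (n + 3)) <| .seq (.const (n + 3) 1) <|
    .seq (.loop (n + 2) (scanBody w n P)) (.add (n + 2) (n + 3) (n + 2)),
    .X * (p + 4 + 1) + 5, fun s N hN => ?_⟩
  let ψ : Fin N → Prop := fun j => φ (Fin.snoc (s.env n) (j * w : ℕ)) s.mem N
  have hstep (k : ℕ) (s₁ : State) (hs₁ : ScanInv w n s ψ (k + 1) s₁) :=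
    hs₁.step (B := p.eval N) (P := P) hw fun j s' hs' hj => by
      have := hP s' N ((hs'.2 1 (by omega)).trans hN)
      rwa [State.env_succ, hs'.env_eq, hj, hs'.1] at this
  have hinit : ScanInv w n s ψ N (((s.setReg (n + 3) 0).setReg (n + 2) (N * w)).setReg (n + 3) 1) :=
    ⟨(((State.AgreesBelow.refl _ s).setReg (by omega) _).setReg le_rfl _).setReg (by omega) _,
      by simp, le_rfl, by simp, by simp⟩
  have hone : 1 ≠ n + 3 := by omega
  refine ((Run.const _ _ _).seq_haltsWithin <| (Run.add _ _ _ _).seq_haltsWithin <|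
    (Run.const _ _ _).seq_haltsWithin <|
    (HaltsWithin.loop (Inv := ScanInv w n s ψ) (k := N) (fun s₁ hs₁ => by simp [hs₁.cursor]) hstep
      (by simpa [hone, hN] using hinit)).seq fun s₁ hs₁ =>
    (Run.add _ _ _ _).haltsWithin ⟨hs₁.agrees.setReg le_rfl _, ?_⟩).mono ?_ fun _ => id
  · simp only [Polynomial.eval_add, Polynomial.eval_mul, Polynomial.eval_X,
      Polynomial.eval_one, Polynomial.eval_ofNat]
    omega
  · simpa [hs₁.cursor] using hs₁.answer

theorem forall_records {m n : ℕ} {φ : Pred (n + m)} (hw : 0 < w)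
    (h : PolyDecidable w (n + m) φ) :
    PolyDecidable w n fun e mem N =>
      ∀ J : Fin m → Fin N, φ (Fin.append e fun i => (J i * w : ℕ)) mem N := by
  induction m with
  | zero =>
    refine h.of_iff fun e mem N => ?_
    simp [Fin.append_right_nil]
  | succ m ih =>
    refine (ih (forall_record hw h)).of_iff fun e mem N => ?_
    have hsnoc (J : Fin m → Fin N) (j : Fin N) :
        (fun i => ((Fin.snoc J j : Fin (m + 1) → Fin N) i * w : ℕ)) =
          Fin.snoc (fun i => (J i * w : ℕ)) (j * w : ℕ) :=
      Fin.comp_snoc (fun j : Fin N => (j * w : ℕ)) J j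
    rw [← (Fin.snocEquiv fun _ => Fin N).forall_congr_right, Prod.forall, forall_comm]
    simp only [Fin.snocEquiv, Equiv.coe_fn_mk, hsnoc, Fin.append_snoc]

theorem exists_records {m n : ℕ} {φ : Pred (n + m)} (hw : 0 < w)
    (h : PolyDecidable w (n + m) φ) :
    PolyDecidable w n fun e mem N =>
      ∃ J : Fin m → Fin N, φ (Fin.append e fun i => (J i * w : ℕ)) mem N :=
  (forall_records hw h.not).not.of_iff fun _ _ _ => by simp

end PolyDecidable

end Machine

/-! ### Databases in memory -/

section Memory

variable {Q : CQ} {mem mem' : ℕ → ℕ} {a b : ℕ} {f : Fact Q} {N : ℕ} {r : Fin N → Fact Q}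

/-- The memory holds the record of the fact `f` at the address `a`. -/
def StoresAt (mem : ℕ → ℕ) (a : ℕ) (f : Fact Q) : Prop :=
  mem a = f.1 ∧ ∀ A : {A : Fin Q.numAttr // A ∈ Q.attr f.1}, mem (a + 1 + A.1) = f.2 A

theorem StoresAt.of_eq (h : StoresAt mem a f)
    (hmem : ∀ x < 1 + Q.numAttr, mem' (b + x) = mem (a + x)) :
    StoresAt mem' b f := by
  refine ⟨(hmem 0 (by omega)).trans h.1, fun A => ?_⟩
  rw [add_assoc, hmem _ (by omega), ← add_assoc, h.2]

theorem StoresAt.eq_mk_proj_iff (h : StoresAt mem a f) {i : Fin Q.numRel} {t : Fin Q.numAttr → ℕ} :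
    f = ⟨i, proj (Q.attr i) t⟩ ↔
      mem a = i ∧ ∀ A : {A // A ∈ Q.attr i}, mem (a + 1 + A.1) = t A := by
  obtain ⟨i', u⟩ := f
  constructor
  · rintro ⟨⟩
    exact h
  · rintro ⟨hi, ht⟩
    obtain rfl : i' = i := Fin.ext (h.1.symm.trans hi)
    exact congrArg (Sigma.mk i') (funext fun A => (h.2 A).symm.trans (ht A))

/-- The memory from address `0` on holds the records of the facts `r 0, …, r (N - 1)`. -/
def Encodes (mem : ℕ → ℕ) (r : Fin N → Fact Q) : Prop :=
  ∀ j : Fin N, StoresAt mem (j * (1 + Q.numAttr)) (r j)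

theorem holds_iff {s : State} {D : Database Q} :
    Holds Q s D ↔ ∃ (N : ℕ) (r : Fin N → Fact Q), Function.Injective r ∧
      Finset.univ.image r = D ∧ s.reg 0 = N ∧ Encodes s.mem r := by
  constructor
  · rintro ⟨l, hl, rfl, hN, hmem⟩
    refine ⟨l.length, l.get, List.nodup_iff_injective_get.1 hl, ?_, hN, fun j => hmem j j.2⟩
    ext f
    simp [List.mem_iff_get]
  · rintro ⟨N, r, hr, rfl, hN, hmem⟩
    refine ⟨List.ofFn r, List.nodup_ofFn.2 hr, ?_, by simpa using hN, fun j hj => ?_⟩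
    · ext f
      simp [List.mem_ofFn]
    · rw [List.getElem_ofFn]
      exact hmem ⟨j, by simpa using hj⟩

/-- A relation in which the attribute `A` occurs. -/
noncomputable def CQ.relOf (Q : CQ) (A : Fin Q.numAttr) : Fin Q.numRel := (Q.covered A).choose

theorem CQ.mem_attr_relOf (A : Fin Q.numAttr) : A ∈ Q.attr (Q.relOf A) := (Q.covered A).choose_spec

/-- The tuple over all attributes that takes the value at each attribute `A` from the record at the
address `a (Q.relOf A)`. -/
noncomputable def CQ.joinedTuple (Q : CQ) (mem : ℕ → ℕ) (a : Fin Q.numRel → ℕ) :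
    Fin Q.numAttr → ℕ :=
  fun A => mem (a (Q.relOf A) + 1 + A)

/-- The records at the addresses `a i` belong to the relations `i` and have a common extension to a
tuple over all attributes. -/
def CQ.Joinable (Q : CQ) (mem : ℕ → ℕ) (a : Fin Q.numRel → ℕ) : Prop :=
  ∀ i, mem (a i) = i ∧
    ∀ A : {A // A ∈ Q.attr i}, mem (a i + 1 + A.1) = Q.joinedTuple mem a A

theorem CQ.forall_eq_mk_proj_iff {a : Fin Q.numRel → ℕ} {F : Fin Q.numRel → Fact Q}
    (h : ∀ i, StoresAt mem (a i) (F i)) {t : Fin Q.numAttr → ℕ} :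
    (∀ i, F i = ⟨i, proj (Q.attr i) t⟩) ↔ Q.Joinable mem a ∧ Q.joinedTuple mem a = t := by
  simp only [(h _).eq_mk_proj_iff]
  constructor
  · intro ht
    obtain rfl : Q.joinedTuple mem a = t :=
      funext fun A => (ht (Q.relOf A)).2 ⟨A, CQ.mem_attr_relOf A⟩
    exact ⟨ht, rfl⟩
  · rintro ⟨hJ, rfl⟩
    exact hJ

theorem Encodes.mem_result_image_iff (h : Encodes mem r) {S : Finset (Fin N)}
    {u : Tuple Q.head} :
    u ∈ Q.result (S.image r) ↔ ∃ J : Fin Q.numRel → Fin N, (∀ i, J i ∈ S) ∧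
      Q.Joinable mem (fun i => J i * (1 + Q.numAttr)) ∧
        proj Q.head (Q.joinedTuple mem fun i => J i * (1 + Q.numAttr)) = u := by
  constructor
  · rintro ⟨t, ht, rfl⟩
    simp only [Finset.mem_image] at ht
    choose J hJS hJ using ht
    obtain ⟨hJoin, rfl⟩ := (CQ.forall_eq_mk_proj_iff fun i => h (J i)).1 hJ
    exact ⟨J, hJS, hJoin, rfl⟩
  · rintro ⟨J, hJS, hJ, rfl⟩
    have hfacts := (CQ.forall_eq_mk_proj_iff fun i => h (J i)).2 ⟨hJ, rfl⟩
    exact ⟨_, fun i => hfacts i ▸ Finset.mem_image_of_mem r (hJS i), rfl⟩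

/-- Every query result has a witness among the `N` records that avoids the record at the address
`e 0`. -/
def CQ.Redundant (Q : CQ) : Pred 1 := fun e mem N =>
  ∀ J : Fin Q.numRel → Fin N, Q.Joinable mem (fun i => J i * (1 + Q.numAttr)) →
    ∃ K : Fin Q.numRel → Fin N, Q.Joinable mem (fun i => K i * (1 + Q.numAttr)) ∧
      (∀ i, (K i * (1 + Q.numAttr) : ℕ) ≠ e 0) ∧
        ∀ A : {A // A ∈ Q.head}, Q.joinedTuple mem (fun i => K i * (1 + Q.numAttr)) A =
          Q.joinedTuple mem (fun i => J i * (1 + Q.numAttr)) A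

theorem Encodes.redundant_iff (h : Encodes mem r)
    (hr : Function.Injective r) (c : Fin N) :
    Q.Redundant (fun _ => c * (1 + Q.numAttr)) mem N ↔
      Q.result ((Finset.univ.image r).erase (r c)) = Q.result (Finset.univ.image r) := by
  have hne (K : Fin Q.numRel → Fin N) (i : Fin Q.numRel) :
      (K i * (1 + Q.numAttr) : ℕ) ≠ c * (1 + Q.numAttr) ↔ K i ∈ Finset.univ.erase c := by
    simp [Fin.val_inj]
  rw [← Finset.image_erase hr]
  constructor
  · intro hred
    refine (CQ.result_mono (Finset.image_subset_image (Finset.erase_subset c _))).antisymm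
      fun u hu => ?_
    obtain ⟨J, -, hJ, rfl⟩ := h.mem_result_image_iff.1 hu
    obtain ⟨K, hK, hKc, hKJ⟩ := hred J hJ
    exact h.mem_result_image_iff.2 ⟨K, fun i => (hne K i).1 (hKc i), hK, funext hKJ⟩
  · intro heq J hJ
    obtain ⟨K, hKc, hK, hKJ⟩ := h.mem_result_image_iff.1
      (heq.ge (h.mem_result_image_iff.2 ⟨J, fun i => Finset.mem_univ (J i), hJ, rfl⟩))
    exact ⟨K, hK, fun i => (hne K i).2 (hKc i), congrFun hKJ⟩

theorem CQ.polyDecidable_joinable {w n : ℕ} (v : Fin Q.numRel → Fin n) :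
    PolyDecidable w n fun e mem _ => Q.Joinable mem fun i => e (v i) :=
  .forall_finite fun _ => .and (.eq (.load (.var _)) (.const _)) <|
    .forall_finite fun A => .eq (.load (((Evaluable.var _).add (.const 1)).add (.const A)))
      (.load (((Evaluable.var _).add (.const 1)).add (.const A)))

theorem CQ.polyDecidable_redundant (Q : CQ) : PolyDecidable (1 + Q.numAttr) 1 Q.Redundant := by
  have hw : 0 < 1 + Q.numAttr := by omega
  have hvalue {n : ℕ} (v : Fin Q.numRel → Fin n) (A : Fin Q.numAttr) :
      Evaluable n fun e mem => Q.joinedTuple mem (fun i => e (v i)) A :=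
    .load (((Evaluable.var _).add (.const 1)).add (.const A))
  let c : Fin (1 + Q.numRel + Q.numRel) := (Fin.castAdd Q.numRel 0).castAdd Q.numRel
  let j : Fin Q.numRel → Fin (1 + Q.numRel + Q.numRel) := fun i => (i.natAdd 1).castAdd Q.numRel
  let k : Fin Q.numRel → Fin (1 + Q.numRel + Q.numRel) := fun i => i.natAdd (1 + Q.numRel)
  have hK : PolyDecidable (1 + Q.numAttr) (1 + Q.numRel + Q.numRel) fun e mem _ =>
      Q.Joinable mem (fun i => e (k i)) ∧ (∀ i, e (k i) ≠ e c) ∧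
        ∀ A : {A // A ∈ Q.head}, Q.joinedTuple mem (fun i => e (k i)) A =
          Q.joinedTuple mem (fun i => e (j i)) A :=
    .and (polyDecidable_joinable k) <|
      .and (.forall_finite fun _ => .not (.eq (.var _) (.var _))) <|
        .forall_finite fun A => .eq (hvalue k A) (hvalue j A)
  refine (PolyDecidable.forall_records hw <|
    (polyDecidable_joinable (Fin.natAdd 1)).imp (.exists_records hw hK)).of_iff fun e mem N => ?_
  simp only [CQ.Redundant, c, j, k, Fin.append_left, Fin.append_right]

end Memory

/-! ### Greedy deletion of redundant facts -/

section SwapRemove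

variable {α : Type*} {N : ℕ} {r : Fin (N + 1) → α} {c : Fin (N + 1)} {j : Fin N}

/-- The list without its entry number `c`, whose place is taken by the last entry. -/
def swapRemove (r : Fin (N + 1) → α) (c : Fin (N + 1)) : Fin N → α :=
  fun j => r (Equiv.swap c (Fin.last N) j.castSucc)

theorem swapRemove_of_eq (h : j.castSucc = c) : swapRemove r c j = r (Fin.last N) := by
  rw [swapRemove, h, Equiv.swap_apply_left]

theorem swapRemove_of_ne (h : j.castSucc ≠ c) : swapRemove r c j = r j.castSucc := by
  rw [swapRemove, Equiv.swap_apply_of_ne_of_ne h (Fin.castSucc_ne_last j)]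

theorem swapRemove_injective (hr : Function.Injective r) (c : Fin (N + 1)) :
    Function.Injective (swapRemove r c) :=
  hr.comp ((Equiv.swap c (Fin.last N)).injective.comp (Fin.castSucc_injective N))

theorem image_swapRemove [DecidableEq α] (hr : Function.Injective r) (c : Fin (N + 1)) :
    Finset.univ.image (swapRemove r c) = (Finset.univ.image r).erase (r c) := by
  have himage : Finset.univ.image (fun j : Fin N => Equiv.swap c (Fin.last N) j.castSucc) =
      Finset.univ.erase c := by
    ext i
    simp [Equiv.swap_apply_eq_iff, Fin.exists_castSucc_eq]
  rw [← Finset.image_erase hr, ← himage, Finset.image_image]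
  rfl

end SwapRemove

section Copy

variable {s : State}

/-- Copy `b` words from the address in register `1` to the address in register `2`. -/
def copyProg : ℕ → Prog
  | 0 => .skip
  | b + 1 => .seq (copyProg b) <| .seq (.const 3 b) <| .seq (.add 4 1 3) <| .seq (.load 4 4) <|
      .seq (.add 3 2 3) (.store 3 4)

theorem haltsWithin_copyProg (b : ℕ) (hsep : s.reg 2 = s.reg 1 ∨ s.reg 2 + b ≤ s.reg 1) :
    HaltsWithin (copyProg b) s (5 * b + 1) fun s' => (∀ r < 3, s'.reg r = s.reg r) ∧
      (∀ x < b, s'.mem (s.reg 2 + x) = s.mem (s.reg 1 + x)) ∧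
      ∀ a, a < s.reg 2 ∨ s.reg 2 + b ≤ a → s'.mem a = s.mem a := by
  induction b with
  | zero => exact (Run.skip s).haltsWithin ⟨fun _ _ => rfl, by simp, fun _ _ => rfl⟩
  | succ b ih =>
    refine ((ih (by omega)).seq fun s₁ ⟨hreg, hnew, hold⟩ => ((Run.const _ _ _).seq <|
      (Run.add _ _ _ _).seq <| (Run.load _ _ _).seq <| (Run.add _ _ _ _).seq <|
      Run.store _ _ _).haltsWithin ⟨fun r hr => ?_, fun x hx => ?_, fun a ha => ?_⟩).mono
      (by omega) fun _ => id
    · have h3 : r ≠ 3 := by omega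
      have h4 : r ≠ 4 := by omega
      simp [h3, h4, hreg r hr]
    · rcases Nat.lt_succ_iff_lt_or_eq.1 hx with hx | rfl
      · simp [hreg, hnew x hx, hx.ne]
      · simp [hreg, hold _ (show s.reg 1 + x < s.reg 2 ∨ s.reg 2 + x ≤ s.reg 1 + x by omega)]
    · have hne : a ≠ s.reg 2 + b := by omega
      simp [hreg, hne, hold a (by omega)]

/-- Store `b` times the content of register `0` in register `1`. -/
def mulProg : ℕ → Prog
  | 0 => .const 1 0
  | b + 1 => .seq (mulProg b) (.add 1 1 0)

theorem haltsWithin_mulProg (b : ℕ) (s : State) :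
    HaltsWithin (mulProg b) s (b + 1) fun s' => s.AgreesBelow 1 s' ∧ s'.reg 1 = s.reg 0 * b := by
  induction b with
  | zero =>
    exact (Run.const _ _ _).haltsWithin ⟨(State.AgreesBelow.refl 1 s).setReg le_rfl _, by simp⟩
  | succ b ih =>
    exact ih.seq fun s₁ ⟨hs₁, h1⟩ => (Run.add _ _ _ _).haltsWithin
      ⟨hs₁.setReg le_rfl _, by simp [h1, hs₁.2 0 one_pos, Nat.mul_add]⟩

end Copy

section Greedy

variable {Q : CQ} {D : Database Q} {N : ℕ} {s s' : State}

theorem Encodes.swapRemove {mem mem' : ℕ → ℕ} {r : Fin (N + 1) → Fact Q} {c : Fin (N + 1)}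
    (h : Encodes mem r)
    (hnew : ∀ x < 1 + Q.numAttr,
      mem' (c * (1 + Q.numAttr) + x) = mem (N * (1 + Q.numAttr) + x))
    (hold : ∀ a, a < c * (1 + Q.numAttr) ∨ c * (1 + Q.numAttr) + (1 + Q.numAttr) ≤ a →
      mem' a = mem a) :
    Encodes mem' (swapRemove r c) := by
  intro j
  by_cases hj : j.castSucc = c
  · rw [swapRemove_of_eq hj]
    refine (h (Fin.last N)).of_eq fun x hx => ?_
    simpa [← hj] using hnew x hx
  · rw [swapRemove_of_ne hj]
    refine (h j.castSucc).of_eq fun x hx => hold _ ?_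
    rcases lt_or_gt_of_ne (Fin.val_ne_of_ne hj) with hjc | hjc
    all_goals
      rw [Fin.val_castSucc] at hjc
      have := Nat.mul_le_mul_right (1 + Q.numAttr) (Nat.succ_le_of_lt hjc)
      rw [Nat.succ_mul] at this
      omega

/-- The state `s` holds the facts `r 0, …, r (N - 1)`. Register `1` contains the end address of the
records, and register `2` the address of record `k`. -/
structure HoldsList (s : State) (r : Fin N → Fact Q) (k : ℕ) : Prop where
  size : s.reg 0 = N
  endAddr : s.reg 1 = N * (1 + Q.numAttr)
  cursor : s.reg 2 = k * (1 + Q.numAttr)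
  encodes : Encodes s.mem r

theorem HoldsList.of_agreesBelow {r : Fin N → Fact Q} {k : ℕ} (h : HoldsList s r k)
    (hs : s.AgreesBelow 3 s') : HoldsList s' r k where
  size := (hs.2 0 (by omega)).trans h.size
  endAddr := (hs.2 1 (by omega)).trans h.endAddr
  cursor := (hs.2 2 (by omega)).trans h.cursor
  encodes := hs.1 ▸ h.encodes

/-- Delete the record of length `w` whose address is in register `2`. -/
def removeProg (w : ℕ) : Prog :=
  .seq (.const 3 1) <| .seq (.sub 0 0 3) <| .seq (.const 3 w) <| .seq (.sub 1 1 3) (copyProg w)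

theorem HoldsList.haltsWithin_removeProg {r : Fin (N + 1) → Fact Q} {c : Fin (N + 1)}
    (h : HoldsList s r c) :
    HaltsWithin (removeProg (1 + Q.numAttr)) s (5 * (1 + Q.numAttr) + 5)
      fun s' => HoldsList s' (swapRemove r c) c := by
  have hend : s.reg 1 - (1 + Q.numAttr) = N * (1 + Q.numAttr) := by
    rw [h.endAddr, Nat.succ_mul, Nat.add_sub_cancel]
  have hsep : (c * (1 + Q.numAttr) : ℕ) = N * (1 + Q.numAttr) ∨
      c * (1 + Q.numAttr) + (1 + Q.numAttr) ≤ N * (1 + Q.numAttr) := by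
    rcases c.le_last.eq_or_lt with rfl | hc
    · exact .inl rfl
    · rw [← Nat.succ_mul]
      exact .inr (Nat.mul_le_mul_right _ hc)
  refine ((Run.const _ _ _).seq_haltsWithin <| (Run.sub _ _ _ _).seq_haltsWithin <|
    (Run.const _ _ _).seq_haltsWithin <| (Run.sub _ _ _ _).seq_haltsWithin <|
    haltsWithin_copyProg _ (by simpa [hend, h.cursor] using hsep)).mono (by omega)
    fun s' ⟨hreg, hnew, hold⟩ => ?_
  simp only [State.reg_setReg, State.mem_setReg, ne_eq, OfNat.zero_ne_ofNat, OfNat.one_ne_ofNat,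
    OfNat.ofNat_ne_one, OfNat.ofNat_ne_zero, one_ne_zero, Nat.reduceEqDiff, not_false_eq_true,
    Function.update_of_ne, Function.update_self, hend, h.cursor] at hreg hnew hold
  exact ⟨by simp [hreg, h.size], by simp [hreg], by simp [hreg, h.cursor],
    h.encodes.swapRemove hnew hold⟩

theorem CQ.result_erase_ne {f g : Fact Q}
    (hf : Q.result (D.erase f) ≠ Q.result D) (hg : Q.result (D.erase g) = Q.result D) :
    Q.result ((D.erase g).erase f) ≠ Q.result (D.erase g) := fun h =>
  hf ((CQ.result_mono (Finset.erase_subset _ _)).antisymm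
    (hg ▸ h ▸ CQ.result_mono (Finset.erase_subset_erase _ (Finset.erase_subset _ _))))

/-- The list `r` enumerates a witness for `D` without repetition, in which the facts from `r k` on
are not redundant. -/
structure ListsWitness (D : Database Q) (r : Fin N → Fact Q) (k : ℕ) : Prop where
  injective : Function.Injective r
  isWitness : IsWitness Q D (Finset.univ.image r)
  result_erase_ne : ∀ j : Fin N, k ≤ j →
    Q.result ((Finset.univ.image r).erase (r j)) ≠ Q.result (Finset.univ.image r)

theorem ListsWitness.le_card {r : Fin N → Fact Q} {k : ℕ} (h : ListsWitness D r k) :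
    N ≤ D.card := by
  simpa [Finset.card_image_of_injective _ h.injective] using Finset.card_le_card h.isWitness.1

theorem ListsWitness.of_ne {r : Fin N → Fact Q} {c : Fin N} (h : ListsWitness D r (c + 1))
    (hc : Q.result ((Finset.univ.image r).erase (r c)) ≠ Q.result (Finset.univ.image r)) :
    ListsWitness D r c := by
  refine ⟨h.injective, h.isWitness, fun j hj => ?_⟩
  rcases hj.eq_or_lt with hj | hj
  · exact (Fin.ext hj : c = j) ▸ hc
  · exact h.result_erase_ne j hj

theorem ListsWitness.swapRemove {r : Fin (N + 1) → Fact Q} {c : Fin (N + 1)}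
    (h : ListsWitness D r (c + 1))
    (hc : Q.result ((Finset.univ.image r).erase (r c)) = Q.result (Finset.univ.image r)) :
    ListsWitness D (swapRemove r c) c := by
  have himage := image_swapRemove h.injective c
  refine ⟨swapRemove_injective h.injective c, ?_, fun j hj => ?_⟩ <;> rw [himage]
  · exact ⟨(Finset.erase_subset _ _).trans h.isWitness.1, hc.trans h.isWitness.2⟩
  · refine CQ.result_erase_ne ?_ hc
    by_cases hjc : j.castSucc = c
    · rw [swapRemove_of_eq hjc]
      exact h.result_erase_ne _ (by simp [← hjc])
    · rw [swapRemove_of_ne hjc]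
      exact h.result_erase_ne _ (lt_of_le_of_ne hj fun h => hjc (Fin.ext h.symm))

theorem ListsWitness.isUnionOfSmallestWitnesses {r : Fin N → Fact Q} (h : ListsWitness D r 0) :
    IsUnionOfSmallestWitnesses Q D (Finset.univ.image r) := by
  refine isUnionOfSmallestWitnesses_of_minimal h.isWitness fun f hf => ?_
  obtain ⟨j, -, rfl⟩ := Finset.mem_image.1 hf
  exact h.result_erase_ne j (Nat.zero_le _)

/-- The body of the greedy algorithm, where `P` decides redundancy. The records are visited from the
last to the first. -/
def greedyBody (w : ℕ) (P : Prog) : Prog :=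
  .seq (.const 3 w) <| .seq (.sub 2 2 3) <| .seq P <| .ifZero 3 .skip (removeProg w)

/-- The invariant of the greedy algorithm: the state holds a witness for `D`, and the records from
number `k` on have been visited and are not redundant. -/
def GreedyInv (D : Database Q) (k : ℕ) (s : State) : Prop :=
  ∃ (N : ℕ) (r : Fin N → Fact Q), k ≤ N ∧ HoldsList s r k ∧ ListsWitness D r k

theorem haltsWithin_greedyBody {P : Prog} {T : ℕ} {r : Fin (N + 1) → Fact Q} {c : Fin (N + 1)}
    (hP : ∀ s, HoldsList s r c → HaltsWithin P s T fun s' => s.AgreesBelow 3 s' ∧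
      (s'.reg 3 ≠ 0 ↔
        Q.result ((Finset.univ.image r).erase (r c)) = Q.result (Finset.univ.image r)))
    (hs : HoldsList s r (c + 1 : ℕ)) (hr : ListsWitness D r (c + 1)) :
    HaltsWithin (greedyBody (1 + Q.numAttr) P) s (T + (5 * (1 + Q.numAttr) + 8))
      (GreedyInv D c) := by
  have hs₀ : HoldsList ((s.setReg 3 (1 + Q.numAttr)).setReg 2 (s.reg 2 - (1 + Q.numAttr))) r c :=
    ⟨by simp [hs.size], by simp [hs.endAddr], by simp [hs.cursor, Nat.succ_mul], hs.encodes⟩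
  refine ((Run.const _ _ _).seq_haltsWithin <| (Run.sub _ _ _ _).seq_haltsWithin <|
    (hP _ hs₀).seq (T' := 5 * (1 + Q.numAttr) + 6) fun s₁ ⟨hs₁, hred⟩ =>
      .ifZero (fun h0 => ?_) fun h0 => ?_).mono (by omega) fun _ => id
  · exact ((Run.skip _).haltsWithin ⟨N + 1, r, c.2.le, hs₀.of_agreesBelow hs₁,
      hr.of_ne fun h => hred.2 h h0⟩).mono (by omega) fun _ => id
  · exact (hs₀.of_agreesBelow hs₁).haltsWithin_removeProg.mono le_rfl fun s' hs' =>
      ⟨N, swapRemove r c, Nat.le_of_lt_succ c.2, hs', hr.swapRemove (hred.1 h0)⟩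

theorem exists_greedyInv_step (Q : CQ) : ∃ (P : Prog) (p : Polynomial ℕ), ∀ (D : Database Q) k s,
    GreedyInv D (k + 1) s → s.reg 2 ≠ 0 ∧
      HaltsWithin P s (p.eval D.card) fun s' => ∃ k' ≤ k, GreedyInv D k' s' := by
  obtain ⟨P, p, hP⟩ := CQ.polyDecidable_redundant Q
  refine ⟨greedyBody (1 + Q.numAttr) P, p + .C (5 * (1 + Q.numAttr) + 8), fun D k s => ?_⟩
  rintro ⟨_ | N, r, hkN, hs, hr⟩
  · omega
  refine ⟨by simp [hs.cursor], (haltsWithin_greedyBody (T := p.eval D.card) (c := ⟨k, hkN⟩)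
    (fun s₁ hs₁ => ?_) hs hr).mono (by simp) fun s' hs' => ⟨k, le_rfl, hs'⟩⟩
  refine (hP s₁ (N + 1) hs₁.endAddr).mono (monotone_polynomial_eval p hr.le_card) fun s₂ hs₂ => ?_
  have henv : s₁.env 1 = fun _ => k * (1 + Q.numAttr) :=
    funext fun i => by simpa [State.env] using hs₁.cursor
  rwa [← hs₁.encodes.redundant_iff hr.injective ⟨k, hkN⟩, ← henv]

theorem solvableInPolyTime_isUnionOfSmallestWitnesses (Q : CQ) :
    SolvableInPolyTime Q (IsUnionOfSmallestWitnesses Q) := by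
  obtain ⟨P, p, hP⟩ := exists_greedyInv_step Q
  refine ⟨.seq (mulProg (1 + Q.numAttr)) <| .seq (.const 2 0) <| .seq (.add 2 1 2) (.loop 2 P),
    .X * (p + 1) + .C (Q.numAttr + 5), fun D s hs => ?_⟩
  obtain ⟨N, r, hr, rfl, h0, henc⟩ := holds_iff.1 hs
  have hcard : (Finset.univ.image r).card = N := by simp [Finset.card_image_of_injective _ hr]
  have hlists : ListsWitness (Finset.univ.image r) r N :=
    ⟨hr, ⟨subset_rfl, rfl⟩, fun j hj => absurd j.2 hj.not_gt⟩
  have hhalts := (haltsWithin_mulProg (1 + Q.numAttr) s).seq fun s₁ ⟨hs₁, h1⟩ =>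
    (Run.const 2 0 s₁).seq_haltsWithin <| (Run.add 2 1 2 _).seq_haltsWithin <|
      HaltsWithin.loop (k := N)
        (fun s' ⟨_, _, _, hs', _⟩ => by simpa using hs'.cursor) (hP (Finset.univ.image r))
        ⟨N, r, le_rfl, ⟨by simp [hs₁.2 0, h0], by simp [h1, h0], by simp [h1, h0],
          by simpa [hs₁.1] using henc⟩, hlists⟩
  obtain ⟨s', t, hrun, ht, N', r', -, hs', hr'⟩ := hhalts
  refine ⟨s', t, _, hrun, ht.trans ?_,
    holds_iff.2 ⟨N', r', hr'.injective, rfl, hs'.size, hs'.encodes⟩,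
    hr'.isUnionOfSmallestWitnesses⟩
  simp only [hcard, Polynomial.eval_add, Polynomial.eval_mul, Polynomial.eval_X,
    Polynomial.eval_one, Polynomial.eval_C]
  omega

end Greedy

theorem SolvableInPolyTime.mono {Q : CQ} {Spec Spec' : Database Q → Database Q → Prop}
    (h : SolvableInPolyTime Q Spec) (hSpec : ∀ D D', Spec D D' → Spec' D D') :
    SolvableInPolyTime Q Spec' := by
  obtain ⟨P, p, hP⟩ := h
  refine ⟨P, p, fun D s hs => ?_⟩
  obtain ⟨s', n, D', hrun, hn, hD', hSpecD⟩ := hP D s hs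
  exact ⟨s', n, D', hrun, hn, hD', hSpec D D' hSpecD⟩

end SWP

theorem mainTheorem5 (Q : SWP.CQ) (hQ : 0 < Q.numAttr) :
    SWP.IsApproximable Q Q.ratio ∧
      (∀ D D' : SWP.Database Q, SWP.IsUnionOfSmallestWitnesses Q D D' →
        SWP.IsApproxSolution Q (Q.ratio D.card) D D') ∧
      SWP.SolvableInPolyTime Q (SWP.IsUnionOfSmallestWitnesses Q) := by
  have hsolv := SWP.solvableInPolyTime_isUnionOfSmallestWitnesses Q
  have happrox : ∀ D D' : SWP.Database Q, SWP.IsUnionOfSmallestWitnesses Q D D' →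
      SWP.IsApproxSolution Q (Q.ratio D.card) D D' := fun _ _ h => h.isApproxSolution hQ
  exact ⟨hsolv.mono happrox, happrox, hsolv⟩
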